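/- Let $d_{2,11}(n)$ denote the number of binary words of length $n$ that contain at most $11$ distinct palindromic factors (contiguous blocks that equal their own reversal), the empty word being counted as a palindromic factor. Then $$\begin{aligned}(d_{2,11}(0),\ldots,d_{2,11}(41)) = (&1,2,4,8,16,32,64,128,256,512,1024,292,270,268,276,276,288,320,340,364,388,\\&404,428,476,512,560,610,644,692,768,840,924,1020,1100,1190,1316,1452,\\&1612,1786,1952,2134,2348),\end{aligned}$$ and for all $n\ge 42$ $$\begin{aligned} d_{2,11}(n) ={}& -d_{2,11}(n-1)-d_{2,11}(n-2)-d_{2,11}(n-3)-d_{2,11}(n-4)-d_{2,11}(n-5)+2d_{2,11}(n-6)\\ &+4d_{2,11}(n-7)+5d_{2,11}(n-8)+5d_{2,11}(n-9)+5d_{2,11}(n-10)+5d_{2,11}(n-11)\\ &+2d_{2,11}(n-12)-3d_{2,11}(n-13)-6d_{2,11}(n-14)-8d_{2,11}(n-15)-8d_{2,11}(n-16)\\ &-8d_{2,11}(n-17)-7d_{2,11}(n-18)-3d_{2,11}(n-19)+3d_{2,11}(n-21)+4d_{2,11}(n-22)\\ &+4d_{2,11}(n-23)+4d_{2,11}(n-24)+3d_{2,11}(n-25)+2d_{2,11}(n-26)+d_{2,11}(n-27).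 \end{aligned}$$ Moreover $d_{2,11}(n)\sim c\cdot\alpha^n$ as $n\to\infty$, where $\alpha$ is the largest real zero of $X^7-X-1$, and, to the digits shown, $\alpha\doteq 1.1127756842787054706297$ and $c\doteq 20.665$ (that is, $|\alpha-1.1127756842787054706297|<\tfrac12\cdot10^{-22}$ and $|c-20.665|<\tfrac12\cdot10^{-3}$). -/

import Mathlib

open Asymptotics Filter

/-- The set of palindromic factors of a finite word `w`, the empty word included.
A factor is a contiguous block: `x <:+: w` means `w = y ++ x ++ z` for some `y`, `z`. -/
def PalFac {A : Type*} (w : List A) : Set (List A) :=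
  {x | x <:+: w ∧ x.Palindrome}

/-- The language of all finite words over `A` that contain at most `l` distinct palindromes as
factors, where the empty word counts as a palindrome. -/
def palLanguage (A : Type*) (l : ℕ) : Language A :=
  {w | (PalFac w).encard ≤ l}

/-- `palCount k l n` is the number of words of length `n` over the `k`-letter alphabet `Fin k`
that contain at most `l` distinct palindromic factors, the empty word included. -/
noncomputable def palCount (k l n : ℕ) : ℕ :=
  {w : List (Fin k) | w ∈ palLanguage (Fin k) l ∧ w.length = n}.ncard

/-! A binary palindrome of length 12 or 13 contains at least 12 distinct palindromes of length at
most 11 (a finite check), and every longer palindrome has one of these at its centre. So membership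
in the language depends only on the palindromic factors of length at most 11 (`mem_palLanguage`).
Prepending a letter adds only palindromic prefixes of length at most 11, so a state made of the set
of palindromes seen and the first 10 letters can be updated letter by letter (`stepK_spec`).
Admissible words are thereby counted by iterating a linear operator `transfer` on functions of
states (`palCount_eq_transfer`).

The recurrence is proved at the level of states: the combination of the multisets of states reached
at lengths 15 to 42, with the coefficients of the recurrence, is zero. The kernel verifies this
together with the initial values (`run_table`, `run_sound`), and applying `transfer` any number of
times propagates the identity to all larger lengths.

The characteristic polynomial factors as `(X^6 - 1)(X^6 + ... + X + 1)(X^8 - X^2 - 1)(X^7 - X - 1)`.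
Only the last factor vanishes at `α`, and the other three have all their roots of modulus less than
`α`. The limit of the count divided by `α ^ n` is found for the factor `X^7 - X - 1`
(`tendsto_div_pow_of_trinomial`) and transported through the others one at a time
(`tendsto_div_pow_of_recurrence`). All estimates are elementary contractions; no complex roots are
used. -/

namespace PalindromeCount

open Topology

/-! ### The counting automaton and its kernel evaluation. -/

/-- Evaluate a natural number to a literal before passing it on: this keeps kernel reduction
call-by-value. -/
def force {β : Type} (x : ℕ) (k : ℕ → β) : β :=
  match x with
  | 0 => k 0
  | n + 1 => k (Nat.succ n)

/-- The bits are the codes of the nonempty binary palindromes of length at most `11`. -/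
def palMask : ℕ :=
  522194440828159121088061395864196704348223156298129973892232338294494377404544808647004276649813723239253959327313450624653887373927794757413163986134330166791588612557399714081246233375701493207110041073289186464484445649176356077017182845922372613063759521713938697742075179014265973128253085636791754854613803871643613851699505012644972747798315617747714162598261322768001713792304931879934283669499805770191543779588654092938549302629762156857100027690068062701077495742937150001491153345573485537599879906968187436682045110042271212067068412385948762495350931295769482685482760073318717779123663340668794049761943088636658645343766108140211025580310166616376340718407271320496995309509588415524448450216872053264035999426292924550192507442117283630967540316389160479457081473797753042710050178282314918886187743026379021558125806405823087696233045976211453852156378840291597775265802605021931922627990032463724664016091545637894425732478960208820615797140058439699111834275266104107274406948065577093432598191339341485431254054195908047065834646585399807406067311521064680656086473296634238409845263762747622013693586744676381374331332356334198301572907457011730425765704515623574262365221636634382504562664482906363113991415196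

/-- A state of the counting automaton: the number and the bit set of the palindromes seen, and
the code of the last few letters. -/
structure St where
  num : ℕ
  mask : ℕ
  win : ℕ

/-- If the word coded by `s` has a palindromic prefix of length `k`, where `p = 2 ^ k`, add its
code to the palindromes seen. -/
def addPal {β : Type} (s p : ℕ) (c : ℕ → ℕ → β) (n m : ℕ) : β :=
  bif Nat.ble p s then
    force (Nat.add (Nat.mod s p) p) fun x =>
      bif Nat.beq (Nat.mod (Nat.shiftRight palMask x) 2) 1 then
        bif Nat.beq (Nat.mod (Nat.shiftRight m x) 2) 1 then c n m
        else force (Nat.lor m (Nat.shiftLeft 1 x)) fun m' => c (Nat.succ n) m'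
      else c n m
  else c n m

/-- The transition of the counting automaton, in continuation-passing style. -/
def stepK {β : Type} (a : ℕ) (q : St) (c : St → β) : β :=
  force (Nat.add (Nat.mul 2 q.win) a) fun s =>
    addPal s 2 (addPal s 4 (addPal s 8 (addPal s 16 (addPal s 32 (addPal s 64 (addPal s 128
      (addPal s 256 (addPal s 512 (addPal s 1024 (addPal s 2048 fun n m =>
        force n fun n' =>
          -- A code of at least `2 ^ 11` means 11 letters; the last of them, no longer needed, is
          -- dropped by keeping the low 10 digits under a new leading 1.
          force (bif Nat.ble 2048 s then Nat.add (Nat.mod s 1024) 1024 else s) fun s' =>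
            c ⟨n', m, s'⟩)))))))))) q.num q.mask

/-- Search trees holding states, each with a pair of multiplicities. -/
inductive Tree where
  | leaf : Tree
  | node : St → ℕ → ℕ → Tree → Tree → Tree

/-- Add a state with its multiplicities to a tree, in continuation-passing style. -/
def insK {β : Type} (q : St) (a b : ℕ) : Tree → (Tree → β) → β
  | .leaf, c => c (.node q a b .leaf .leaf)
  | .node r a' b' L R, c =>
    bif Nat.beq q.win r.win && (Nat.beq q.mask r.mask && Nat.beq q.num r.num) then
      force (Nat.add a a') fun x => force (Nat.add b b') fun y => c (.node r x y L R)
    -- The sort key only serves the speed of the search: soundness rests on the equality test alone,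
    -- even if a state were stored twice.
    else bif Nat.ble (Nat.add q.mask q.win) (Nat.add r.mask r.win) then
      insK q a b L fun L' => c (.node r a' b' L' R)
    else insK q a b R fun R' => c (.node r a' b' L R')

/-- Insert the successors of all states of a tree into another tree. -/
def nextK {β : Type} : Tree → Tree → (Tree → β) → β
  | .leaf, acc, c => c acc
  | .node q a b L R, acc, c =>
    stepK 0 q fun q0 => stepK 1 q fun q1 =>
      let go := fun acc => bif Nat.ble q1.num 11
        then insK q1 a b acc fun acc => nextK L acc fun acc => nextK R acc c
        else nextK L acc fun acc => nextK R acc c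
      bif Nat.ble q0.num 11 then insK q0 a b acc go else go acc

/-- Insert the states of a tree, with multiplicities scaled by `(p, m)`, into another tree. -/
def scaleK {β : Type} (p m : ℕ) : Tree → Tree → (Tree → β) → β
  | .leaf, acc, c => c acc
  | .node q a _ L R, acc, c =>
    force (Nat.mul p a) fun x => force (Nat.mul m a) fun y =>
      insK q x y acc fun acc => scaleK p m L acc fun acc => scaleK p m R acc c

/-- The sum of the first multiplicities. -/
def total : Tree → ℕ
  | .leaf => 0
  | .node _ a _ L R => a + (total L + total R)

/-- The two multiplicities agree at every node. -/
def balanced : Tree → Bool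
  | .leaf => true
  | .node _ a b L R => Nat.beq a b && (balanced L && balanced R)

/-- With `T` holding the states of the admissible words of some length, check the numbers of words
listed for this and the following lengths, and that the linear combination of the corresponding
multisets of states with the listed coefficients, added to `F`, vanishes. -/
def run : List (ℕ × ℕ × ℕ) → Tree → Tree → Bool
  | [], _, F => balanced F
  | (d, p, m) :: l, T, F =>
    Nat.beq (total T) d &&
      (bif Nat.beq (p + m) 0 then nextK T .leaf fun T' => run l T' F
       else scaleK p m T F fun F' => nextK T .leaf fun T' => run l T' F')

/-- For `n = 0, …, 42`: the number of words of length `n`, and the positive and negative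
parts of the coefficient with which length `n` enters the recurrence. -/
def table : List (ℕ × ℕ × ℕ) :=
  [(1, 0, 0), (2, 0, 0), (4, 0, 0), (8, 0, 0), (16, 0, 0), (32, 0, 0), (64, 0, 0),
   (128, 0, 0), (256, 0, 0), (512, 0, 0), (1024, 0, 0), (292, 0, 0), (270, 0, 0), (268, 0, 0),
   (276, 0, 0), (276, 0, 1), (288, 0, 2), (320, 0, 3), (340, 0, 4), (364, 0, 4), (388, 0, 4),
   (404, 0, 3), (428, 0, 0), (476, 3, 0), (512, 7, 0), (560, 8, 0), (610, 8, 0), (644, 8, 0),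
   (692, 6, 0), (768, 3, 0), (840, 0, 2), (924, 0, 5), (1020, 0, 5), (1100, 0, 5),
   (1190, 0, 5), (1316, 0, 4), (1452, 0, 2), (1612, 1, 0), (1786, 1, 0), (1952, 1, 0),
   (2134, 1, 0), (2348, 1, 0), (2598, 1, 0)]

/-- The state of the empty word. -/
def init : St := ⟨1, 2, 1⟩

/-- The vanishing is tested state by state, which is stronger than the numerical recurrence at
length 42 and is what lets it propagate to all larger lengths. -/
theorem run_table : run table (.node init 1 0 .leaf .leaf) .leaf = true := by
  decide +kernel

/-! ### Coding binary words by numbers. -/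

/-- The code of a binary word: its letters as binary digits, least significant first, below a
leading `1`. -/
def code : List (Fin 2) → ℕ
  | [] => 1
  | a :: w => 2 * code w + a

theorem code_pos (w : List (Fin 2)) : 0 < code w := by
  induction w with
  | nil => simp [code]
  | cons a w ih => simp only [code]; omega

theorem code_bounds (w : List (Fin 2)) : 2 ^ w.length ≤ code w ∧ code w < 2 ^ (w.length + 1) := by
  induction w with
  | nil => simp [code]
  | cons a w ih =>
    have := a.isLt
    simp only [code, List.length_cons, pow_succ] at *
    omega

theorem code_injective : Function.Injective code := by
  intro v
  induction v with
  | nil =>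
    rintro (_ | ⟨b, w⟩) h
    · rfl
    · have := code_pos w
      simp only [code] at h; omega
  | cons a v ih =>
    rintro (_ | ⟨b, w⟩) h
    · have := code_pos v
      simp only [code] at h; omega
    · have ha := a.isLt
      have hb := b.isLt
      simp only [code] at h
      rw [ih (show code v = code w by omega), Fin.ext (show a.val = b.val by omega)]

theorem two_pow_le_code {k : ℕ} {w : List (Fin 2)} : 2 ^ k ≤ code w ↔ k ≤ w.length := by
  obtain ⟨h1, h2⟩ := code_bounds w
  constructor
  · intro h
    have := (Nat.pow_lt_pow_iff_right (a := 2) (by norm_num)).1 (h.trans_lt h2)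
    omega
  · exact fun h => (Nat.pow_le_pow_right (by norm_num) h).trans h1

/-- The first letters are the low binary digits, so a prefix is a remainder with a new leading 1. -/
theorem code_take {k : ℕ} {w : List (Fin 2)} (h : k ≤ w.length) :
    code w % 2 ^ k + 2 ^ k = code (w.take k) := by
  induction k generalizing w with
  | zero => simp [code, Nat.mod_one]
  | succ k ih =>
    rcases w with _ | ⟨a, w⟩
    · simp at h
    · have := ih (w := w) (by simpa using h)
      have ha := a.isLt
      simp only [code, List.take_succ_cons, ← this]
      rw [pow_succ', Nat.mod_mul, Nat.mul_add_mod, Nat.mod_eq_of_lt ha,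
        show (2 * code w + a) / 2 = code w by omega]
      ring

/-- All binary words of length `n`. -/
def words : ℕ → List (List (Fin 2))
  | 0 => [[]]
  | n + 1 => (words n).flatMap fun w => [0 :: w, 1 :: w]

theorem mem_words {n : ℕ} {w : List (Fin 2)} : w ∈ words n ↔ w.length = n := by
  induction n generalizing w with
  | zero => simp [words]
  | succ n ih =>
    rcases w with _ | ⟨a, w⟩
    · simp [words]
    · fin_cases a <;> simp [words, ih]

/-- Exhaustive check of the literal `palMask` on all 4094 words of length 1 to 11. -/
theorem palMask_words : ∀ k ∈ List.range 11, ∀ w ∈ words (k + 1),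
    (palMask >>> code w % 2 = 1 ↔ w.reverse = w) := by
  decide +kernel

theorem palMask_code {w : List (Fin 2)} (h0 : 0 < w.length) (h : w.length ≤ 11) :
    palMask >>> code w % 2 = 1 ↔ w.Palindrome := by
  rw [List.Palindrome.iff_reverse_eq]
  exact palMask_words (w.length - 1) (by simp; omega) w (mem_words.2 (by omega))

/-! ### Correctness of the automaton. -/

/-- The natural numbers `n` and `m` are the cardinality and the bit set of codes of `S`. -/
structure Rep (S : Set (List (Fin 2))) (n m : ℕ) : Prop where
  finite : S.Finite
  card : S.ncard = n
  bits : ∀ i, m >>> i % 2 = 1 ↔ ∃ x ∈ S, code x = i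

theorem force_eq {β : Type} (x : ℕ) (k : ℕ → β) : force x k = k x := by
  cases x <;> rfl

theorem shiftRight_mod_two (m i : ℕ) : m >>> i % 2 = 1 ↔ m.testBit i = true := by
  rw [Nat.testBit_eq_decide_div_mod_eq, Nat.shiftRight_eq_div_pow]; simp

theorem Rep.insert {S : Set (List (Fin 2))} {n m : ℕ} (h : Rep S n m) {x : List (Fin 2)}
    (hx : x ∉ S) : Rep (insert x S) (n + 1) (m ||| 1 <<< code x) := by
  refine ⟨h.finite.insert x, ?_, fun i => ?_⟩
  · rw [Set.ncard_insert_of_notMem hx h.finite, h.card]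
  · rw [shiftRight_mod_two, Nat.testBit_or, Nat.one_shiftLeft, Nat.testBit_two_pow]
    have := h.bits i
    rw [shiftRight_mod_two] at this
    simp [this, or_comm]

/-- The prefix of length `k` of `u`, provided that it exists and is a palindrome. -/
def palPrefix (u : List (Fin 2)) (k : ℕ) : Set (List (Fin 2)) :=
  {x | x = u.take k ∧ k ≤ u.length ∧ x.Palindrome}

/-- The pair `n'`, `m'` is chosen before the continuation, so that `addPal` in continuation-passing
style is seen to return a value. The same form is used for `stepK` and the tree operations. -/
theorem addPal_spec {S : Set (List (Fin 2))} {n m : ℕ} (h : Rep S n m) (k : ℕ) (hk0 : 0 < k)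
    (hk : k ≤ 11) (u : List (Fin 2)) :
    ∃ n' m', (∀ {β : Type} (c : ℕ → ℕ → β), addPal (code u) (2 ^ k) c n m = c n' m') ∧
      Rep (S ∪ palPrefix u k) n' m' := by
  by_cases hu : k ≤ u.length
  · have hlen : (u.take k).length = k := by simp [hu]
    have hp := palMask_code (w := u.take k) (by omega) (by omega)
    have hb : Nat.ble (2 ^ k) (code u) = true := by simpa using two_pow_le_code.2 hu
    have hc : Nat.add (Nat.mod (code u) (2 ^ k)) (2 ^ k) = code (u.take k) := code_take hu
    by_cases hpal : (u.take k).Palindrome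
    · by_cases hS : u.take k ∈ S
      · refine ⟨n, m, fun c => ?_, ?_⟩
        · have h1 : (Nat.beq (Nat.mod (Nat.shiftRight palMask (code (u.take k))) 2) 1) = true := by
            exact Nat.beq_eq.mpr (hp.2 hpal)
          have h2 : (Nat.beq (Nat.mod (Nat.shiftRight m (code (u.take k))) 2) 1) = true := by
            exact Nat.beq_eq.mpr ((h.bits _).2 ⟨_, hS, rfl⟩)
          simp only [addPal, force_eq, hb, hc, h1, h2, cond_true]
        · convert h using 1
          ext x
          simp only [palPrefix, Set.mem_union, Set.mem_ofPred_eq, or_iff_left_iff_imp]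
          rintro ⟨rfl, -⟩
          exact hS
      · refine ⟨n + 1, m ||| 1 <<< code (u.take k), fun c => ?_, ?_⟩
        · have h1 : (Nat.beq (Nat.mod (Nat.shiftRight palMask (code (u.take k))) 2) 1) = true := by
            exact Nat.beq_eq.mpr (hp.2 hpal)
          have h2 : (Nat.beq (Nat.mod (Nat.shiftRight m (code (u.take k))) 2) 1) = false := by
            rw [Bool.eq_false_iff]
            intro hf
            obtain ⟨x, hx, hxe⟩ := (h.bits (code (u.take k))).1 (Nat.eq_of_beq_eq_true hf)
            exact hS (code_injective hxe ▸ hx)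
          simp only [addPal, force_eq, hb, hc, h1, h2, cond_true, cond_false]
          rfl
        · convert h.insert hS using 1
          ext x
          simp only [palPrefix, Set.mem_union, Set.mem_ofPred_eq, Set.mem_insert_iff]
          constructor
          · rintro (hx | ⟨hx, -⟩)
            exacts [Or.inr hx, Or.inl hx]
          · rintro (rfl | hx)
            exacts [Or.inr ⟨rfl, hu, hpal⟩, Or.inl hx]
    · refine ⟨n, m, fun c => ?_, ?_⟩
      · have h1 : (Nat.beq (Nat.mod (Nat.shiftRight palMask (code (u.take k))) 2) 1) = false := by
          rw [Bool.eq_false_iff]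
          exact fun hf => hpal (hp.1 (Nat.eq_of_beq_eq_true hf))
        simp only [addPal, force_eq, hb, hc, h1, cond_true, cond_false]
      · convert h using 1
        ext x
        simp only [palPrefix, Set.mem_union, Set.mem_ofPred_eq, or_iff_left_iff_imp]
        rintro ⟨rfl, -, h⟩
        exact absurd h hpal
  · refine ⟨n, m, fun c => ?_, ?_⟩
    · have hb : Nat.ble (2 ^ k) (code u) = false := by
        rw [Bool.eq_false_iff]
        intro hf
        exact hu (two_pow_le_code.1 (Nat.le_of_ble_eq_true hf))
      simp only [addPal, hb, cond_false]
    · convert h using 1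
      ext x
      simp only [palPrefix, Set.mem_union, Set.mem_ofPred_eq, or_iff_left_iff_imp]
      exact fun h => absurd h.2.1 hu

/-- The palindromic factors of length at most `11`. -/
def shortPal (w : List (Fin 2)) : Set (List (Fin 2)) :=
  {x | x <:+: w ∧ x.Palindrome ∧ x.length ≤ 11}

/-- A factor of `a :: w` that is not a factor of `w` is a nonempty prefix; with length at most 11 it
is visible in `a` followed by 10 letters of `w`. -/
theorem mem_shortPal_cons {a : Fin 2} {w x : List (Fin 2)} :
    x ∈ shortPal (a :: w) ↔ x ∈ shortPal w ∨
      ∃ k, 0 < k ∧ k ≤ 11 ∧ x ∈ palPrefix (a :: w.take 10) k := by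
  simp only [shortPal, palPrefix, Set.mem_ofPred_eq, List.infix_cons_iff]
  constructor
  · rintro ⟨h | h, hp, hl⟩
    · rcases x with _ | ⟨b, x⟩
      · exact Or.inl ⟨List.nil_infix, hp, hl⟩
      · have hle := h.length_le
        refine Or.inr ⟨(b :: x).length, by simp, hl, ?_, ?_, hp⟩
        · rw [List.prefix_iff_eq_take] at h
          rw [← List.take_succ_cons, List.take_take, min_eq_left hl]
          exact h
        · simp at hl hle ⊢; omega
    · exact Or.inl ⟨h, hp, hl⟩
  · rintro (⟨h, hp, hl⟩ | ⟨k, h0, hk, rfl, hl, hp⟩)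
    · exact ⟨Or.inr h, hp, hl⟩
    · refine ⟨Or.inl ?_, hp, by simp [hk]⟩
      rw [← List.take_succ_cons, List.take_take]
      exact List.take_prefix _ _

/-- The state `q` is the one reached after reading `w` from right to left. -/
structure Reached (w : List (Fin 2)) (q : St) : Prop where
  rep : Rep (shortPal w) q.num q.mask
  win : q.win = code (w.take 10)

theorem reached_nil : Reached [] init := by
  have : shortPal [] = {[]} := by
    ext x
    simp only [shortPal, List.infix_nil, Set.mem_ofPred_eq, Set.mem_singleton_iff]
    exact ⟨fun h => h.1, fun h => by subst h; exact ⟨rfl, .nil, by simp⟩⟩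
  refine ⟨⟨?_, ?_, fun i => ?_⟩, rfl⟩
  · rw [this]; exact Set.finite_singleton _
  · rw [this]; simp [init]
  · rw [this, shiftRight_mod_two, show init.mask = 2 ^ 1 from rfl, Nat.testBit_two_pow]
    simp [code]

theorem stepK_spec {w : List (Fin 2)} {q : St} (h : Reached w q) (a : Fin 2) :
    ∃ q', (∀ {β : Type} (c : St → β), stepK a q c = c q') ∧ Reached (a :: w) q' := by
  have hs : Nat.add (Nat.mul 2 q.win) a = code (a :: w.take 10) := by
    rw [h.win]; rfl
  set u := a :: w.take 10 with hu
  obtain ⟨n1, m1, e1, r1⟩ := addPal_spec h.rep 1 (by norm_num) (by norm_num) u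
  obtain ⟨n2, m2, e2, r2⟩ := addPal_spec r1 2 (by norm_num) (by norm_num) u
  obtain ⟨n3, m3, e3, r3⟩ := addPal_spec r2 3 (by norm_num) (by norm_num) u
  obtain ⟨n4, m4, e4, r4⟩ := addPal_spec r3 4 (by norm_num) (by norm_num) u
  obtain ⟨n5, m5, e5, r5⟩ := addPal_spec r4 5 (by norm_num) (by norm_num) u
  obtain ⟨n6, m6, e6, r6⟩ := addPal_spec r5 6 (by norm_num) (by norm_num) u
  obtain ⟨n7, m7, e7, r7⟩ := addPal_spec r6 7 (by norm_num) (by norm_num) u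
  obtain ⟨n8, m8, e8, r8⟩ := addPal_spec r7 8 (by norm_num) (by norm_num) u
  obtain ⟨n9, m9, e9, r9⟩ := addPal_spec r8 9 (by norm_num) (by norm_num) u
  obtain ⟨n10, m10, e10, r10⟩ := addPal_spec r9 10 (by norm_num) (by norm_num) u
  obtain ⟨n11, m11, e11, r11⟩ := addPal_spec r10 11 (by norm_num) (by norm_num) u
  norm_num only at e1 e2 e3 e4 e5 e6 e7 e8 e9 e10 e11
  refine ⟨⟨n11, m11, bif Nat.ble 2048 (code u) then
    Nat.add (Nat.mod (code u) 1024) 1024 else code u⟩, fun c => ?_, ?_, ?_⟩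
  · simp only [stepK, force_eq, hs, e1, e2, e3, e4, e5, e6, e7, e8, e9, e10, e11]
  · convert r11 using 1
    ext x
    rw [mem_shortPal_cons, ← hu]
    constructor
    · rintro (h | ⟨k, h0, hk, h⟩)
      · simp [h]
      · interval_cases k <;> simp [h]
    · simp only [Set.mem_union]
      rintro (((((((((((h | h) | h) | h) | h) | h) | h) | h) | h) | h) | h) | h)
      · exact Or.inl h
      all_goals exact Or.inr ⟨_, by norm_num, by norm_num, h⟩
  · show _ = code (List.take 10 (a :: w))
    have hu' : List.take 10 (a :: w) = u.take 10 := by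
      rw [hu, ← List.take_succ_cons, List.take_take]; rfl
    have hb : Nat.ble 2048 (code u) = true ↔ 11 ≤ u.length := by
      rw [← two_pow_le_code]; simp
    rw [hu']
    by_cases hl : 11 ≤ u.length
    · rw [hb.2 hl]
      exact code_take (k := 10) (by omega)
    · rw [Bool.eq_false_iff.2 (fun h => hl (hb.1 h)), cond_false, List.take_of_length_le (by omega)]

/-- Naturality in the continuation; it allows `stepK` to be replaced by the ordinary function
`step`. -/
theorem apply_addPal {β γ : Type} (d : β → γ) (s p : ℕ) (c : ℕ → ℕ → β) (n m : ℕ) :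
    d (addPal s p c n m) = addPal s p (fun n m => d (c n m)) n m := by
  cases h1 : Nat.ble p s
  · simp only [addPal, h1, cond_false]
  · cases h2 : Nat.beq (Nat.mod (Nat.shiftRight palMask (Nat.add (Nat.mod s p) p)) 2) 1
    · simp only [addPal, force_eq, h1, h2, cond_false, cond_true]
    · cases h3 : Nat.beq (Nat.mod (Nat.shiftRight m (Nat.add (Nat.mod s p) p)) 2) 1 <;>
        simp only [addPal, force_eq, h1, h2, h3, cond_false, cond_true]

theorem apply_stepK {β γ : Type} (d : β → γ) (a : ℕ) (q : St) (c : St → β) :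
    d (stepK a q c) = stepK a q fun q => d (c q) := by
  simp only [stepK, force_eq, apply_addPal d]

/-- The transition of the counting automaton. -/
def step (a : ℕ) (q : St) : St := stepK a q id

theorem stepK_eq {β : Type} (a : ℕ) (q : St) (c : St → β) : stepK a q c = c (step a q) :=
  (apply_stepK c a q id).symm

theorem Reached.step {w : List (Fin 2)} {q : St} (h : Reached w q) (a : Fin 2) :
    Reached (a :: w) (step a q) := by
  obtain ⟨q', e, r⟩ := stepK_spec h a
  rw [PalindromeCount.step, e]
  exact r

/-- The state reached after reading a word from right to left. -/
def state : List (Fin 2) → St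
  | [] => init
  | a :: w => step a (state w)

theorem reached_state (w : List (Fin 2)) : Reached w (state w) := by
  induction w with
  | nil => exact reached_nil
  | cons a w ih => exact ih.step a

theorem shortPal_finite (w : List (Fin 2)) : (shortPal w).Finite := (reached_state w).rep.finite

theorem state_num (w : List (Fin 2)) : (state w).num = (shortPal w).ncard :=
  (reached_state w).rep.card.symm

/-! ### Long palindromes are excluded. -/

theorem shortPal_mono {v w : List (Fin 2)} (h : v <:+: w) : shortPal v ⊆ shortPal w :=
  fun _ hx => ⟨hx.1.trans h, hx.2⟩

theorem ncard_shortPal_mono {v w : List (Fin 2)} (h : v <:+: w) :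
    (shortPal v).ncard ≤ (shortPal w).ncard :=
  Set.ncard_le_ncard (shortPal_mono h) (shortPal_finite w)

/-- Read a word from right to left, in continuation-passing style. -/
def stateK {β : Type} : List (Fin 2) → (St → β) → β
  | [], c => c init
  | a :: w, c => stateK w fun q => stepK a q c

theorem stateK_eq {β : Type} (w : List (Fin 2)) (c : St → β) : stateK w c = c (state w) := by
  induction w generalizing c with
  | nil => rfl
  | cons a w ih => rw [stateK, ih, stepK_eq]; rfl

/-- The words `y ++ (y.take 6).reverse` with `y` of length 6 or 7 include all palindromes of length
12 and 13. -/
theorem stateK_palindromes : ∀ k ∈ [6, 7], ∀ y ∈ words k,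
    stateK (y ++ (y.take 6).reverse) (fun q => Nat.ble 12 q.num) = true := by
  decide +kernel

theorem twelve_le_ncard_of_length {x : List (Fin 2)} (hp : x.Palindrome)
    (h : x.length = 12 ∨ x.length = 13) : 12 ≤ (shortPal x).ncard := by
  have key : ∀ k ∈ [6, 7], x.length = k + 6 → 12 ≤ (shortPal x).ncard := by
    intro k hk hx
    have hk' : 6 ≤ k := by simp at hk; omega
    have h1 : x = x.take k ++ ((x.take k).take 6).reverse := by
      conv_lhs => rw [← List.take_append_drop k x]
      congr 1
      rw [List.take_take, min_eq_left hk', List.reverse_take, hp.reverse_eq, hx]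
      simp
    have h2 := stateK_palindromes k hk (x.take k) (mem_words.2 (by simp; omega))
    rw [← h1, stateK_eq, state_num] at h2
    exact Nat.le_of_ble_eq_true h2
  rcases h with h | h
  · exact key 6 (by simp) h
  · exact key 7 (by simp) h

theorem twelve_le_ncard {x : List (Fin 2)} (hp : x.Palindrome) (h : 12 ≤ x.length) :
    12 ≤ (shortPal x).ncard := by
  induction hp with
  | nil => simp at h
  | singleton a => simp at h
  | @cons_concat a l hl ih =>
    -- Stripping both end letters lowers the length by 2, so the descent stops exactly at length 12
    -- or 13.
    by_cases hl' : 12 ≤ l.length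
    · exact (ih hl').trans (ncard_shortPal_mono ⟨[a], [a], by simp⟩)
    · refine twelve_le_ncard_of_length (.cons_concat a hl) ?_
      simp at h ⊢
      omega

theorem mem_palLanguage {w : List (Fin 2)} :
    w ∈ palLanguage (Fin 2) 11 ↔ (state w).num ≤ 11 := by
  rw [state_num]
  change (PalFac w).encard ≤ (11 : ℕ) ↔ _
  have hsub : shortPal w ⊆ PalFac w := fun x hx => ⟨hx.1, hx.2.1⟩
  by_cases hlong : ∃ x ∈ PalFac w, 12 ≤ x.length
  · obtain ⟨x, hx, hl⟩ := hlong
    have h12 := (twelve_le_ncard hx.2 hl).trans (ncard_shortPal_mono hx.1)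
    refine iff_of_false (fun h => ?_) (by omega)
    have h' := (Set.encard_le_encard hsub).trans h
    rw [← (shortPal_finite w).cast_ncard_eq, Nat.cast_le] at h'
    omega
  · have : PalFac w = shortPal w :=
      Set.Subset.antisymm (fun x hx => ⟨hx.1, hx.2, by by_contra h; exact hlong ⟨x, hx, by omega⟩⟩)
        hsub
    rw [this, ← (shortPal_finite w).cast_ncard_eq, Nat.cast_le]

theorem state_num_cons (a : Fin 2) (w : List (Fin 2)) : (state w).num ≤ (state (a :: w)).num := by
  rw [state_num, state_num]
  exact ncard_shortPal_mono (List.infix_cons (List.infix_rfl))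

theorem nodup_words (n : ℕ) : (words n).Nodup := by
  induction n with
  | zero => simp [words]
  | succ n ih =>
    rw [words, List.nodup_flatMap]
    refine ⟨fun w _ => by simp, ih.imp fun {v w} h => ?_⟩
    simp [Function.onFun, h.symm]

/-! ### Counting by the transfer operator. -/

/-- The sum of `f` over the admissible successors of a state. -/
def transfer (f : St → ℤ) (q : St) : ℤ :=
  (if (step 0 q).num ≤ 11 then f (step 0 q) else 0) +
    if (step 1 q).num ≤ 11 then f (step 1 q) else 0

theorem transfer_iterate_init (n : ℕ) (f : St → ℤ) :
    transfer^[n] f init =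
      ((words n).map fun w => if (state w).num ≤ 11 then f (state w) else 0).sum := by
  induction n generalizing f with
  | zero => simp [words, state, init]
  | succ n ih =>
    rw [Function.iterate_succ_apply, ih, words]
    generalize words n = l
    induction l with
    | nil => simp
    | cons w l ihl =>
      rw [List.map_cons, List.sum_cons, ihl, List.flatMap_cons, List.map_append, List.sum_append]
      congr 1
      by_cases h : (state w).num ≤ 11
      · simp [h, transfer, state]
        rfl
      -- The number of palindromes never decreases under extension, so discarding inadmissible words
      -- early loses nothing.
      · have h0 := state_num_cons 0 w
        have h1 := state_num_cons 1 w
        simp only [List.map_cons, List.map_nil, List.sum_cons, List.sum_nil]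
        rw [if_neg h, if_neg (by omega), if_neg (by omega)]
        rfl

theorem palCount_eq_transfer (n : ℕ) : (palCount 2 11 n : ℤ) = transfer^[n] 1 init := by
  have : {w : List (Fin 2) | w ∈ palLanguage (Fin 2) 11 ∧ w.length = n} =
      ↑((words n).filter fun w => (state w).num ≤ 11).toFinset := by
    ext w
    simp [mem_palLanguage, mem_words, and_comm]
  rw [palCount, this, Set.ncard_coe_finset, List.toFinset_card_of_nodup ((nodup_words n).filter _),
    transfer_iterate_init]
  generalize words n = l
  induction l with
  | nil => simp
  | cons w l ih =>
    rw [List.filter_cons]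
    rw [List.map_cons, List.sum_cons, ← ih]
    by_cases h : (state w).num ≤ 11
    · simp [h, add_comm]
    · simp [h]

/-! ### Soundness of the tree computation, and the recurrence. -/

/-- Evaluate the linear combination of states stored in a tree. -/
def eval (x y : ℤ) (f : St → ℤ) : Tree → ℤ
  | .leaf => 0
  | .node q a b L R => (a * x + b * y) * f q + (eval x y f L + eval x y f R)

theorem apply_insK (q : St) (a b : ℕ) (t : Tree) :
    ∃ t', (∀ {β : Type} (c : Tree → β), insK q a b t c = c t') ∧
      ∀ x y f, eval x y f t' = (a * x + b * y) * f q + eval x y f t := by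
  induction t with
  | leaf => exact ⟨.node q a b .leaf .leaf, fun _ => rfl, fun x y f => by simp [eval]⟩
  | node r a' b' L R ihL ihR =>
    obtain ⟨L', hL, eL⟩ := ihL
    obtain ⟨R', hR, eR⟩ := ihR
    cases h1 : (Nat.beq q.win r.win && (Nat.beq q.mask r.mask && Nat.beq q.num r.num))
    · cases h2 : Nat.ble (Nat.add q.mask q.win) (Nat.add r.mask r.win)
      · refine ⟨.node r a' b' L R', fun c => ?_, fun x y f => ?_⟩
        · simp only [insK, h1, h2, cond_false, hR]
        · simp only [eval, eR]; ring
      · refine ⟨.node r a' b' L' R, fun c => ?_, fun x y f => ?_⟩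
        · simp only [insK, h1, h2, cond_false, cond_true, hL]
        · simp only [eval, eL]; ring
    · refine ⟨.node r (a + a') (b + b') L R, fun c => ?_, fun x y f => ?_⟩
      · simp only [insK, h1, cond_true, force_eq]; rfl
      · obtain ⟨hw, hm, hn⟩ : q.win = r.win ∧ q.mask = r.mask ∧ q.num = r.num := by
          simpa only [Bool.and_eq_true, Nat.beq_eq] using h1
        have hq : q = r := by
          cases q; cases r; simp_all
        simp only [eval, hq, Nat.cast_add]; ring

/-- Advancing the multiset of states is dual to applying `transfer` to the test function. -/
theorem apply_nextK (x y : ℤ) (t acc : Tree) :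
    ∃ t', (∀ {β : Type} (c : Tree → β), nextK t acc c = c t') ∧
      ∀ f, eval x y f t' = eval x y (transfer f) t + eval x y f acc := by
  induction t generalizing acc with
  | leaf => exact ⟨acc, fun _ => rfl, fun f => by simp [eval]⟩
  | node q a b L R ihL ihR =>
    obtain ⟨t0, h0, e0⟩ : ∃ t0, (∀ {β : Type} (c : Tree → β),
        (bif Nat.ble (step 0 q).num 11 then insK (step 0 q) a b acc c else c acc) = c t0) ∧
        ∀ f, eval x y f t0 = (a * x + b * y) *
          (if (step 0 q).num ≤ 11 then f (step 0 q) else 0) + eval x y f acc := by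
      cases h : Nat.ble (step 0 q).num 11
      · have h' : ¬ (step 0 q).num ≤ 11 := fun hf => by simp [Nat.ble_eq_true_of_le hf] at h
        exact ⟨acc, fun c => rfl, fun f => by simp [h']⟩
      · obtain ⟨t', ht, et⟩ := apply_insK (step 0 q) a b acc
        exact ⟨t', fun c => ht c, fun f => by rw [et, if_pos (Nat.le_of_ble_eq_true h)]⟩
    obtain ⟨t1, h1, e1⟩ : ∃ t1, (∀ {β : Type} (c : Tree → β),
        (bif Nat.ble (step 1 q).num 11 then insK (step 1 q) a b t0 c else c t0) = c t1) ∧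
        ∀ f, eval x y f t1 = (a * x + b * y) *
          (if (step 1 q).num ≤ 11 then f (step 1 q) else 0) + eval x y f t0 := by
      cases h : Nat.ble (step 1 q).num 11
      · have h' : ¬ (step 1 q).num ≤ 11 := fun hf => by simp [Nat.ble_eq_true_of_le hf] at h
        exact ⟨t0, fun c => rfl, fun f => by simp [h']⟩
      · obtain ⟨t', ht, et⟩ := apply_insK (step 1 q) a b t0
        exact ⟨t', fun c => ht c, fun f => by rw [et, if_pos (Nat.le_of_ble_eq_true h)]⟩
    obtain ⟨tL, hL, eL⟩ := ihL t1
    obtain ⟨tR, hR, eR⟩ := ihR tL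
    refine ⟨tR, fun c => ?_, fun f => ?_⟩
    · simp only [nextK, stepK_eq]
      rw [h0 (fun acc => bif Nat.ble (step 1 q).num 11
        then insK (step 1 q) a b acc fun acc => nextK L acc fun acc => nextK R acc c
        else nextK L acc fun acc => nextK R acc c),
        h1 (fun acc => nextK L acc fun acc => nextK R acc c), hL, hR]
    · rw [eR, eL, e1, e0]
      simp only [eval, transfer]
      ring

theorem apply_scaleK (p m : ℕ) (t acc : Tree) :
    ∃ t', (∀ {β : Type} (c : Tree → β), scaleK p m t acc c = c t') ∧
      ∀ f, eval 1 (-1) f t' = (p - m) * eval 1 0 f t + eval 1 (-1) f acc := by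
  induction t generalizing acc with
  | leaf => exact ⟨acc, fun _ => rfl, fun f => by simp [eval]⟩
  | node q a b L R ihL ihR =>
    obtain ⟨t0, h0, e0⟩ := apply_insK q (p * a) (m * a) acc
    obtain ⟨tL, hL, eL⟩ := ihL t0
    obtain ⟨tR, hR, eR⟩ := ihR tL
    refine ⟨tR, fun c => ?_, fun f => ?_⟩
    · simp only [scaleK, force_eq]
      exact (h0 _).trans ((hL _).trans (hR _))
    · rw [eR, eL, e0]
      simp only [eval, Nat.cast_mul]
      ring

theorem cast_total (t : Tree) : (total t : ℤ) = eval 1 0 1 t := by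
  induction t with
  | leaf => simp [total, eval]
  | node q a b L R ihL ihR => simp [total, eval, ihL, ihR]

theorem eval_of_balanced {t : Tree} (h : balanced t = true) (f : St → ℤ) :
    eval 1 (-1) f t = 0 := by
  induction t with
  | leaf => rfl
  | node q a b L R ihL ihR =>
    simp only [balanced, Bool.and_eq_true, Nat.beq_eq] at h
    simp [eval, h.1, ihL h.2.1, ihR h.2.2]

/-- The values of `u` are the first components of the list. -/
def HasValues : List (ℕ × ℕ × ℕ) → (ℕ → ℤ) → Prop
  | [], _ => True
  | r :: l, u => u 0 = r.1 ∧ HasValues l fun i => u (i + 1)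

/-- The linear combination of the values of `u` with the coefficients given by the list. -/
def combination : List (ℕ × ℕ × ℕ) → (ℕ → ℤ) → ℤ
  | [], _ => 0
  | r :: l, u => (r.2.1 - r.2.2) * u 0 + combination l fun i => u (i + 1)

theorem run_sound {l : List (ℕ × ℕ × ℕ)} {T F : Tree} (h : run l T F = true) :
    HasValues l (fun i => eval 1 0 (transfer^[i] 1) T) ∧
      ∀ f, eval 1 (-1) f F + combination l (fun i => eval 1 0 (transfer^[i] f) T) = 0 := by
  induction l generalizing T F with
  | nil => exact ⟨trivial, fun f => by simp [combination, eval_of_balanced h]⟩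
  | cons r l ih =>
    obtain ⟨d, p, m⟩ := r
    simp only [run, Bool.and_eq_true, Nat.beq_eq] at h
    obtain ⟨hd, h⟩ := h
    obtain ⟨T', hT, eT⟩ := apply_nextK 1 0 T .leaf
    have eT' : ∀ i f, eval 1 0 (transfer^[i] f) T' = eval 1 0 (transfer^[i + 1] f) T := by
      intro i f
      rw [eT, Function.iterate_succ_apply']
      simp [eval]
    simp only [HasValues, combination]
    have hd' : eval 1 0 (transfer^[0] 1) T = d := by rw [← hd, cast_total]; rfl
    rw [hd']
    cases hc : Nat.beq (p + m) 0
    · obtain ⟨F', hF, eF⟩ := apply_scaleK p m T F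
      simp only [hc, cond_false, hF, hT] at h
      obtain ⟨ih1, ih2⟩ := ih h
      simp only [eT'] at ih1 ih2
      refine ⟨⟨rfl, ih1⟩, fun f => ?_⟩
      have h2 := ih2 f
      rw [eF] at h2
      rw [Function.iterate_zero_apply]
      linear_combination h2
    · simp only [hc, cond_true, hT] at h
      obtain ⟨ih1, ih2⟩ := ih h
      simp only [eT'] at ih1 ih2
      refine ⟨⟨rfl, ih1⟩, fun f => ?_⟩
      have hpm : p = 0 ∧ m = 0 := by
        have := Nat.eq_of_beq_eq_true hc; omega
      rw [hpm.1, hpm.2]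
      simpa using ih2 f

theorem hasValues_table : HasValues table fun n => (palCount 2 11 n : ℤ) := by
  have h := (run_sound run_table).1
  simpa only [eval, Nat.cast_one, Nat.cast_zero, mul_one, mul_zero, add_zero, one_mul,
    ← palCount_eq_transfer] using h

theorem combination_table (k : ℕ) :
    combination table (fun n => (palCount 2 11 (k + n) : ℤ)) = 0 := by
  -- The identity holds for every test function; this choice shifts all lengths by `k`.
  have h := (run_sound run_table).2 (transfer^[k] 1)
  simpa only [eval, Nat.cast_one, Nat.cast_zero, mul_one, mul_zero, add_zero, zero_add, one_mul,
    ← Function.iterate_add_apply, add_comm _ k, ← palCount_eq_transfer] using h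

theorem palCount_initial (i : Fin 42) : palCount 2 11 i =
      ![1, 2, 4, 8, 16, 32, 64, 128, 256, 512, 1024, 292, 270, 268, 276, 276, 288,
        320, 340, 364, 388, 404, 428, 476, 512, 560, 610, 644, 692, 768, 840, 924,
        1020, 1100, 1190, 1316, 1452, 1612, 1786, 1952, 2134, 2348] i := by
  have h := hasValues_table
  simp only [HasValues, table, zero_add, Nat.reduceAdd] at h
  obtain ⟨h0, h1, h2, h3, h4, h5, h6, h7, h8, h9, h10, h11, h12, h13, h14, h15, h16, h17, h18, h19,
    h20, h21, h22, h23, h24, h25, h26, h27, h28, h29, h30, h31, h32, h33, h34, h35, h36, h37, h38,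
    h39, h40, h41, -⟩ := h
  fin_cases i <;> exact Nat.cast_injective (R := ℤ) (by assumption)

theorem palCount_recurrence (n : ℕ) (hn : 42 ≤ n) :
      (palCount 2 11 n : ℤ) =
        - palCount 2 11 (n - 1) - palCount 2 11 (n - 2) - palCount 2 11 (n - 3)
        - palCount 2 11 (n - 4) - palCount 2 11 (n - 5) + 2 * palCount 2 11 (n - 6)
        + 4 * palCount 2 11 (n - 7) + 5 * palCount 2 11 (n - 8) + 5 * palCount 2 11 (n - 9)
        + 5 * palCount 2 11 (n - 10) + 5 * palCount 2 11 (n - 11)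
        + 2 * palCount 2 11 (n - 12) - 3 * palCount 2 11 (n - 13) - 6 * palCount 2 11 (n - 14)
        - 8 * palCount 2 11 (n - 15) - 8 * palCount 2 11 (n - 16)
        - 8 * palCount 2 11 (n - 17) - 7 * palCount 2 11 (n - 18) - 3 * palCount 2 11 (n - 19)
        + 3 * palCount 2 11 (n - 21) + 4 * palCount 2 11 (n - 22)
        + 4 * palCount 2 11 (n - 23) + 4 * palCount 2 11 (n - 24)
        + 3 * palCount 2 11 (n - 25) + 2 * palCount 2 11 (n - 26) + palCount 2 11 (n - 27) := by
  obtain ⟨k, rfl⟩ := Nat.exists_eq_add_of_le' hn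
  have h := combination_table k
  simp only [combination, table, zero_add, Nat.reduceAdd, Nat.cast_zero, Nat.cast_one, sub_self,
    zero_mul, add_zero, sub_zero, one_mul, Nat.cast_ofNat] at h
  simp only [Nat.reduceSubDiff]
  linear_combination h

/-! ### Asymptotics of linear recurrences. -/

/-- A sequence that is eventually contracted over windows of length `k`, up to a null sequence,
is a null sequence. -/
theorem tendsto_zero_of_contraction {v h : ℕ → ℝ} {k : ℕ} {ρ : ℝ} (hρ0 : 0 ≤ ρ) (hρ : ρ < 1)
    (hh : Tendsto h atTop (𝓝 0))
    (hv : ∀ n B, (∀ j < k, |v (n + j)| ≤ B) → |v (n + k)| ≤ ρ * B + h n) :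
    Tendsto v atTop (𝓝 0) := by
  obtain ⟨H, hH⟩ : ∃ H, ∀ n, h n ≤ H := by
    obtain ⟨H, hH⟩ := hh.bddAbove_range
    exact ⟨H, fun n => hH ⟨n, rfl⟩⟩
  have h1ρ : 0 < 1 - ρ := by linarith
  have hbdd : ∃ B, 0 ≤ B ∧ ∀ n, |v n| ≤ B := by
    have hsum : 0 ≤ ∑ i ∈ Finset.range k, |v i| := Finset.sum_nonneg fun _ _ => abs_nonneg _
    have hB : |H| / (1 - ρ) * (1 - ρ) = |H| := div_mul_cancel₀ _ h1ρ.ne'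
    have hq : 0 ≤ |H| / (1 - ρ) := by positivity
    -- This bound covers the first `k` terms and is preserved by `B ↦ ρ * B + H`.
    refine ⟨∑ i ∈ Finset.range k, |v i| + |H| / (1 - ρ), by positivity, fun n => ?_⟩
    induction n using Nat.strong_induction_on with
    | _ n ih =>
      by_cases hn : n < k
      · have := Finset.single_le_sum (f := fun i => |v i|) (fun i _ => abs_nonneg _)
          (Finset.mem_range.2 hn)
        linarith
      · obtain ⟨m, rfl⟩ := Nat.exists_eq_add_of_le' (not_lt.1 hn)
        have h1 := hv m _ fun j hj => ih (m + j) (by omega)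
        have h2 := (hH m).trans (le_abs_self H)
        nlinarith
  -- The infimum of the eventual bounds is the upper limit of `|v n|`; by `hstep` it is at most `ρ`
  -- times itself, hence zero.
  set S : Set ℝ := {B | 0 ≤ B ∧ ∀ᶠ n in atTop, |v n| ≤ B} with hS
  have hSne : S.Nonempty := by
    obtain ⟨B, hB0, hB⟩ := hbdd
    exact ⟨B, hB0, Eventually.of_forall hB⟩
  have hSb : BddBelow S := ⟨0, fun B hB => hB.1⟩
  have hstep : ∀ B ∈ S, ∀ ε > 0, ρ * B + ε ∈ S := by
    rintro B ⟨hB0, hB⟩ ε hε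
    refine ⟨by positivity, ?_⟩
    obtain ⟨N, hN⟩ := eventually_atTop.1 hB
    obtain ⟨M, hM⟩ := eventually_atTop.1 (hh.eventually (gt_mem_nhds hε))
    refine eventually_atTop.2 ⟨N + M + k, fun n hn => ?_⟩
    obtain ⟨m, rfl⟩ := Nat.exists_eq_add_of_le' (show k ≤ n by omega)
    have h1 := hv m B fun j _ => hN _ (by omega)
    have h2 := hM m (by omega)
    linarith
  have hinf : sInf S ≤ 0 := by
    by_contra hpos
    push Not at hpos
    have hε : 0 < (1 - ρ) * sInf S / 4 := by positivity
    obtain ⟨B, hB, hlt⟩ := exists_lt_of_csInf_lt hSne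
      (show sInf S < sInf S + (1 - ρ) * sInf S / 4 by linarith)
    have h1 := csInf_le hSb (hstep B hB _ hε)
    nlinarith
  rw [Metric.tendsto_atTop]
  intro ε hε
  obtain ⟨B, hB, hlt⟩ := exists_lt_of_csInf_lt hSne (hinf.trans_lt hε)
  obtain ⟨N, hN⟩ := eventually_atTop.1 hB.2
  refine ⟨N, fun n hn => ?_⟩
  rw [Real.dist_0_eq_abs]
  exact (hN n hn).trans_lt hlt

/-- If `u` satisfies `u (n + k) = a * u (n + i) + b * u n + g n` and `g n / x ^ n` converges, then
so does `u n / x ^ n`, provided that `|a| * x ^ i + |b| < x ^ k`. -/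
theorem tendsto_div_pow_of_recurrence {u g : ℕ → ℝ} {x a b G : ℝ} {i k : ℕ} (hx : 0 < x)
    (hik : i < k) (hab : |a| * x ^ i + |b| < x ^ k)
    (hu : ∀ n, u (n + k) = a * u (n + i) + b * u n + g n)
    (hg : Tendsto (fun n => g n / x ^ n) atTop (𝓝 G)) :
    Tendsto (fun n => u n / x ^ n) atTop (𝓝 (G / (x ^ k - a * x ^ i - b))) := by
  have hxk : 0 < x ^ k := pow_pos hx k
  have hxi : 0 < x ^ i := pow_pos hx i
  have hden : 0 < x ^ k - a * x ^ i - b := by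
    have := le_abs_self a
    have := le_abs_self b
    nlinarith
  set l := G / (x ^ k - a * x ^ i - b) with hl
  have hlG : l * (x ^ k - a * x ^ i - b) = G := div_mul_cancel₀ _ hden.ne'
  have hlim : Tendsto (fun n => |g n / x ^ n - G| / x ^ k) atTop (𝓝 0) := by
    have := ((hg.sub_const G).abs).div_const (x ^ k)
    simpa using this
  have hzero := tendsto_zero_of_contraction (v := fun n => u n / x ^ n - l) (k := k)
    (ρ := (|a| * x ^ i + |b|) / x ^ k) (by positivity) ((div_lt_one hxk).2 hab) hlim ?_
  · have := hzero.add_const l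
    simpa using this
  · intro n B hB
    have hxn : 0 < x ^ n := pow_pos hx n
    have e : u (n + k) / x ^ (n + k) - l =
        (a * x ^ i * (u (n + i) / x ^ (n + i) - l) + b * (u (n + 0) / x ^ (n + 0) - l) +
          (g n / x ^ n - G)) / x ^ k := by
      rw [hu, ← hlG, pow_add, pow_add]
      simp only [add_zero]
      field_simp
      ring
    have h1 := hB i hik
    have h0 := hB 0 (by omega)
    rw [e, abs_div, abs_of_pos hxk, div_mul_eq_mul_div, ← add_div]
    refine div_le_div_of_nonneg_right ?_ hxk.le
    refine (abs_add_le _ _).trans (add_le_add_left ((abs_add_le _ _).trans ?_) _)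
    rw [abs_mul, abs_mul, abs_mul, abs_of_pos hxi, add_mul]
    gcongr

/-- Solutions of the recurrence with characteristic polynomial `X ^ 7 - X - 1` grow like powers of
its real root. -/
theorem tendsto_div_pow_of_trinomial {e : ℕ → ℝ} {x : ℝ} (hx1 : 1 < x) (hx2 : x < 1.12)
    (hx : x ^ 7 = x + 1) (he : ∀ n, e (n + 7) = e (n + 1) + e n) :
    Tendsto (fun n => e n / x ^ n) atTop (𝓝 ((e 6 + x * e 5 + x ^ 2 * e 4 + x ^ 3 * e 3 +
      x ^ 4 * e 2 + x ^ 5 * e 1 + (x ^ 6 - 1) * e 0) / (7 * x ^ 6 - 1))) := by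
  have hx0 : 0 < x := by linarith
  have hx6 : 1 < x ^ 6 := one_lt_pow₀ hx1 (by norm_num)
  have hden : 0 < 7 * x ^ 6 - 1 := by linarith
  set l := (e 6 + x * e 5 + x ^ 2 * e 4 + x ^ 3 * e 3 +
      x ^ 4 * e 2 + x ^ 5 * e 1 + (x ^ 6 - 1) * e 0) / (7 * x ^ 6 - 1) with hl
  have hlG := div_mul_cancel₀ (e 6 + x * e 5 + x ^ 2 * e 4 + x ^ 3 * e 3 +
      x ^ 4 * e 2 + x ^ 5 * e 1 + (x ^ 6 - 1) * e 0) hden.ne'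
  rw [← hl] at hlG
  have hx42 : x ^ 42 = (x + 1) ^ 6 := by
    rw [← hx]
    ring
  -- The invariant in `hinv` has the coefficients of `(X^7 - X - 1) / (X - x)`, whose value at `x`
  -- is `7 * x ^ 6 - 1`. It is multiplied by `x` at each shift, and `l` is chosen so that it
  -- vanishes on `d`.
  set d : ℕ → ℝ := fun n => e n - l * x ^ n with hd
  have hd7 : ∀ n, d (n + 7) = d (n + 1) + d n := by
    intro n
    simp only [hd, he, pow_add, hx]
    ring
  have hinv : ∀ n, d (n + 6) + x * d (n + 5) + x ^ 2 * d (n + 4) + x ^ 3 * d (n + 3) +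
      x ^ 4 * d (n + 2) + x ^ 5 * d (n + 1) + (x ^ 6 - 1) * d n = 0 := by
    intro n
    induction n with
    | zero =>
      simp only [hd, zero_add]
      linear_combination -hlG
    | succ n ih =>
      simp only [add_assoc, Nat.reduceAdd, hd7]
      linear_combination x * ih - d n * hx
  -- The recurrence of order 7 has `1 + x = x ^ 7`, so by itself it gives no strict contraction.
  -- Reducing `X^42` to `(X + 1)^6` makes all coefficients large enough to subtract the vanishing
  -- invariant and keep them nonnegative; their weighted sum then drops to `x ^ 42 - (7 * x ^ 6 -
  -- 1)`.
  have hd42 : ∀ n, d (n + 42) = d (n + 6) + 6 * d (n + 5) + 15 * d (n + 4) + 20 * d (n + 3) +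
      15 * d (n + 2) + 6 * d (n + 1) + d n := by
    intro n
    have h : ∀ i, d (n + i + 7) = d (n + i + 1) + d (n + i) := fun i => hd7 (n + i)
    simp only [add_assoc] at h
    -- The multipliers are the coefficients of `(Y^6 - Z^6) / (Y - Z)` at `Y = X^7`, `Z = X + 1`.
    linear_combination h 0 + 5 * h 1 + 10 * h 2 + 10 * h 3 + 5 * h 4 + h 5 + h 7 + 4 * h 8 +
      6 * h 9 + 4 * h 10 + h 11 + h 14 + 3 * h 15 + 3 * h 16 + h 17 + h 21 + 2 * h 22 +
      h 23 + h 28 + h 29 + h 35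
  have hzero := tendsto_zero_of_contraction (v := fun n => d n / x ^ n) (k := 42)
    (h := fun _ => 0) (ρ := 1 - (7 * x ^ 6 - 1) / x ^ 42) ?_ ?_ tendsto_const_nhds ?_
  · have := hzero.add_const l
    simp only [zero_add] at this
    refine this.congr fun n => ?_
    simp only [hd]
    field_simp
    ring
  · rw [sub_nonneg, div_le_one (by positivity), hx42]
    have h1 : x ^ 6 ≤ 1.12 ^ 6 := by gcongr
    have h2 : (2 : ℝ) ^ 6 ≤ (x + 1) ^ 6 := by gcongr; linarith
    norm_num at h1 h2
    linarith
  · have : 0 < (7 * x ^ 6 - 1) / x ^ 42 := by positivity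
    linarith
  · intro n B hB
    have hxn : 0 < x ^ n := pow_pos hx0 n
    have hpow : ∀ j ≤ 6, x ^ j < 2 := by
      intro j hj
      calc x ^ j ≤ x ^ 6 := pow_le_pow_right₀ hx1.le hj
        _ ≤ 1.12 ^ 6 := by gcongr
        _ < 2 := by norm_num
    have hbound : ∀ c : ℝ, 0 ≤ c → ∀ j < 42,
        -(c * (B * x ^ n * x ^ j)) ≤ c * d (n + j) ∧ c * d (n + j) ≤ c * (B * x ^ n * x ^ j) := by
      intro c hc j hj
      have h := hB j hj
      rw [abs_div, abs_of_pos (pow_pos hx0 _), div_le_iff₀ (pow_pos hx0 _), pow_add,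
        ← mul_assoc] at h
      rw [← abs_le, abs_mul, abs_of_nonneg hc]
      gcongr
    have b0 := hbound (2 - x ^ 6) (by linarith [hpow 6 (by norm_num)]) 0 (by norm_num)
    have b1 := hbound (6 - x ^ 5) (by linarith [hpow 5 (by norm_num)]) 1 (by norm_num)
    have b2 := hbound (15 - x ^ 4) (by linarith [hpow 4 (by norm_num)]) 2 (by norm_num)
    have b3 := hbound (20 - x ^ 3) (by linarith [hpow 3 (by norm_num)]) 3 (by norm_num)
    have b4 := hbound (15 - x ^ 2) (by linarith [hpow 2 (by norm_num)]) 4 (by norm_num)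
    have b5 := hbound (6 - x) (by linarith) 5 (by norm_num)
    have e42 : d (n + 42) = (2 - x ^ 6) * d (n + 0) + (6 - x ^ 5) * d (n + 1) +
        (15 - x ^ 4) * d (n + 2) + (20 - x ^ 3) * d (n + 3) + (15 - x ^ 2) * d (n + 4) +
        (6 - x) * d (n + 5) := by
      rw [hd42, add_zero]
      linear_combination hinv n
    have hρ : (1 - (7 * x ^ 6 - 1) / x ^ 42) * B * x ^ (n + 42) =
        (2 - x ^ 6) * (B * x ^ n * x ^ 0) + (6 - x ^ 5) * (B * x ^ n * x ^ 1) +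
        (15 - x ^ 4) * (B * x ^ n * x ^ 2) + (20 - x ^ 3) * (B * x ^ n * x ^ 3) +
        (15 - x ^ 2) * (B * x ^ n * x ^ 4) + (6 - x) * (B * x ^ n * x ^ 5) := by
      have hx42' : 0 < x ^ 42 := by positivity
      have : (1 - (7 * x ^ 6 - 1) / x ^ 42) * x ^ 42 = x ^ 42 - (7 * x ^ 6 - 1) := by
        rw [sub_mul, div_mul_cancel₀ _ hx42'.ne', one_mul]
      rw [pow_add]
      linear_combination B * x ^ n * this + B * x ^ n * hx42
    rw [add_zero, abs_div, abs_of_pos (pow_pos hx0 _), div_le_iff₀ (pow_pos hx0 _), hρ, e42, abs_le]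
    constructor <;>
      linarith [b0.1, b0.2, b1.1, b1.2, b2.1, b2.2, b3.1, b3.2, b4.1, b4.2, b5.1, b5.2]

/-! ### The dominant root and the constant. -/

theorem exists_root : ∃ x : ℝ, 1.1127756842787054706297 < x ∧
    x < 1.1127756842787054706297 + 10 ^ (-23 : ℤ) ∧ x ^ 7 = x + 1 := by
  have hc : ContinuousOn (fun x : ℝ => x ^ 7 - x - 1)
      (Set.Icc 1.1127756842787054706297 (1.1127756842787054706297 + 10 ^ (-23 : ℤ))) := by
    fun_prop
  obtain ⟨x, hx, h⟩ := intermediate_value_Ioo (by norm_num) hc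
    (show (0 : ℝ) ∈ Set.Ioo _ _ by constructor <;> norm_num)
  exact ⟨x, hx.1, hx.2, by simp only at h; linarith⟩

theorem isGreatest_root {x : ℝ} (hx1 : 1 < x) (hx : x ^ 7 = x + 1) :
    IsGreatest {x : ℝ | x ^ 7 - x - 1 = 0} x := by
  refine ⟨by simp [hx], fun y hy => ?_⟩
  by_contra! hlt
  have hy' : y ^ 7 - y - 1 = 0 := hy
  -- A root satisfies `y * (y ^ 6 - 1) = 1`, and the left side is strictly increasing beyond 1.
  have h6 : x ^ 6 < y ^ 6 := by gcongr
  have h1 : 1 < x ^ 6 := one_lt_pow₀ hx1 (by norm_num)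
  nlinarith

theorem palCount_tendsto {x : ℝ} (hx1 : 1 < x) (hx2 : x < 1.12) (hx : x ^ 7 = x + 1) :
    Tendsto (fun n : ℕ => (palCount 2 11 n : ℝ) / x ^ n) atTop
      (𝓝 ((192 + 176 * x + 160 * x ^ 2 + 144 * x ^ 3 + 128 * x ^ 4 + 112 * x ^ 5 +
        100 * (x ^ 6 - 1)) / ((x + 1) ^ 2 * (6 * x + 7)))) := by
  have hx0 : 0 < x := by linarith
  -- The shift by 15 is the least length entering the recurrence at `n = 42`.
  set D : ℕ → ℝ := fun n => (palCount 2 11 (n + 15) : ℝ) with hD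
  have hrec : ∀ n, D (n + 27) = - D (n + 26) - D (n + 25) - D (n + 24) - D (n + 23) - D (n + 22)
      + 2 * D (n + 21) + 4 * D (n + 20) + 5 * D (n + 19) + 5 * D (n + 18) + 5 * D (n + 17)
      + 5 * D (n + 16) + 2 * D (n + 15) - 3 * D (n + 14) - 6 * D (n + 13) - 8 * D (n + 12)
      - 8 * D (n + 11) - 8 * D (n + 10) - 7 * D (n + 9) - 3 * D (n + 8) + 3 * D (n + 6)
      + 4 * D (n + 5) + 4 * D (n + 4) + 4 * D (n + 3) + 3 * D (n + 2) + 2 * D (n + 1) + D n := by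
    intro n
    have h := palCount_recurrence (n + 42) (by omega)
    simp only [Nat.reduceSubDiff] at h
    have h' := congrArg (Int.cast : ℤ → ℝ) h
    push_cast at h'
    simpa only [hD, Nat.add_assoc, Nat.reduceAdd] using h'
  -- The factors `X^6 - 1`, `X^6 + ... + 1` and `X^8 - X^2 - 1` are applied in turn, leaving `e`
  -- with the trinomial recurrence.
  set t : ℕ → ℝ := fun n => D (n + 6) - D n with ht
  set s : ℕ → ℝ := fun n => t (n + 6) + t (n + 5) + t (n + 4) + t (n + 3) + t (n + 2) + t (n + 1)
    + t n with hs
  set e : ℕ → ℝ := fun n => s (n + 8) - s (n + 2) - s n with he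
  have he7 : ∀ n, e (n + 7) = e (n + 1) + e n := by
    intro n
    have h := hrec n
    simp only [he, hs, ht, add_assoc, Nat.reduceAdd] at h ⊢
    linarith
  have d0 : D 0 = 276 := congrArg Nat.cast (palCount_initial 15)
  have d1 : D 1 = 288 := congrArg Nat.cast (palCount_initial 16)
  have d2 : D 2 = 320 := congrArg Nat.cast (palCount_initial 17)
  have d3 : D 3 = 340 := congrArg Nat.cast (palCount_initial 18)
  have d4 : D 4 = 364 := congrArg Nat.cast (palCount_initial 19)
  have d5 : D 5 = 388 := congrArg Nat.cast (palCount_initial 20)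
  have d6 : D 6 = 404 := congrArg Nat.cast (palCount_initial 21)
  have d7 : D 7 = 428 := congrArg Nat.cast (palCount_initial 22)
  have d8 : D 8 = 476 := congrArg Nat.cast (palCount_initial 23)
  have d9 : D 9 = 512 := congrArg Nat.cast (palCount_initial 24)
  have d10 : D 10 = 560 := congrArg Nat.cast (palCount_initial 25)
  have d11 : D 11 = 610 := congrArg Nat.cast (palCount_initial 26)
  have d12 : D 12 = 644 := congrArg Nat.cast (palCount_initial 27)
  have d13 : D 13 = 692 := congrArg Nat.cast (palCount_initial 28)
  have d14 : D 14 = 768 := congrArg Nat.cast (palCount_initial 29)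
  have d15 : D 15 = 840 := congrArg Nat.cast (palCount_initial 30)
  have d16 : D 16 = 924 := congrArg Nat.cast (palCount_initial 31)
  have d17 : D 17 = 1020 := congrArg Nat.cast (palCount_initial 32)
  have d18 : D 18 = 1100 := congrArg Nat.cast (palCount_initial 33)
  have d19 : D 19 = 1190 := congrArg Nat.cast (palCount_initial 34)
  have d20 : D 20 = 1316 := congrArg Nat.cast (palCount_initial 35)
  have d21 : D 21 = 1452 := congrArg Nat.cast (palCount_initial 36)
  have d22 : D 22 = 1612 := congrArg Nat.cast (palCount_initial 37)
  have d23 : D 23 = 1786 := congrArg Nat.cast (palCount_initial 38)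
  have d24 : D 24 = 1952 := congrArg Nat.cast (palCount_initial 39)
  have d25 : D 25 = 2134 := congrArg Nat.cast (palCount_initial 40)
  have d26 : D 26 = 2348 := congrArg Nat.cast (palCount_initial 41)
  have he_init : e 0 = 100 ∧ e 1 = 112 ∧ e 2 = 128 ∧ e 3 = 144 ∧ e 4 = 160 ∧ e 5 = 176 ∧
      e 6 = 192 := by
    simp only [he, hs, ht, zero_add, Nat.reduceAdd, d0, d1, d2, d3, d4, d5, d6, d7, d8, d9,
      d10, d11, d12, d13, d14, d15, d16, d17, d18, d19, d20, d21,
      d22, d23, d24, d25, d26]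
    norm_num
  obtain ⟨e0, e1, e2, e3, e4, e5, e6⟩ := he_init
  have hE := tendsto_div_pow_of_trinomial hx1 hx2 hx he7
  rw [e0, e1, e2, e3, e4, e5, e6] at hE
  set N : ℝ := 192 + 176 * x + 160 * x ^ 2 + 144 * x ^ 3 + 128 * x ^ 4 + 112 * x ^ 5 +
        100 * (x ^ 6 - 1) with hN
  have hNe : 192 + x * 176 + x ^ 2 * 160 + x ^ 3 * 144 + x ^ 4 * 128 + x ^ 5 * 112 +
      (x ^ 6 - 1) * 100 = N := by rw [hN]; ring
  rw [hNe] at hE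
  set L := N / (7 * x ^ 6 - 1) with hL
  have hx_one : 0 < x - 1 := sub_pos.2 hx1
  have h8 : x ^ 8 - 1 * x ^ 2 - 1 = x - 1 := by linear_combination x * hx
  have h6 : x * (x ^ 6 - 1) = 1 := by linear_combination hx
  have hS : Tendsto (fun n => s n / x ^ n) atTop (𝓝 (L / (x - 1))) := by
    rw [← h8]
    refine tendsto_div_pow_of_recurrence hx0 (by norm_num) ?_ (fun n => ?_) hE
    · rw [abs_one]; linarith
    · simp only [he]; ring
  -- Multiplying `X^6 + ... + 1` by `X - 1` gives `X^7 - 1`, which has the sparse form required; the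
  -- factor `x - 1` cancels the denominator in `hS`.
  have hST : Tendsto (fun n => (s (n + 1) - s n) / x ^ n) atTop (𝓝 L) := by
    have h := ((hS.comp (tendsto_add_atTop_nat 1)).const_mul x).sub hS
    have hlim : x * (L / (x - 1)) - L / (x - 1) = L := by field_simp
    rw [hlim] at h
    refine h.congr fun n => ?_
    simp only [Function.comp_apply, pow_succ]
    field_simp
  have hT : Tendsto (fun n => t n / x ^ n) atTop (𝓝 (L / (x ^ 7 - 0 * x ^ 0 - 1))) := by
    refine tendsto_div_pow_of_recurrence hx0 (by norm_num) ?_ (fun n => ?_) hST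
    · rw [abs_one, abs_zero]; linarith
    · simp only [hs, Nat.add_assoc, Nat.reduceAdd, Nat.add_comm 1]; ring
  have hDlim : Tendsto (fun n => D n / x ^ n) atTop
      (𝓝 (L / (x ^ 7 - 0 * x ^ 0 - 1) / (x ^ 6 - 0 * x ^ 0 - 1))) := by
    refine tendsto_div_pow_of_recurrence hx0 (by norm_num) ?_ (fun n => ?_) hT
    · rw [abs_one, abs_zero, zero_mul, zero_add]; exact one_lt_pow₀ hx1 (by norm_num)
    · simp only [ht]; ring
  -- Here `x ^ 7 - 1 = x` and `x * (x ^ 6 - 1) = 1`, so both divisors cancel, while `x ^ 14 = (x +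
  -- 1) ^ 2` and `x * (7 * x ^ 6 - 1) = 6 * x + 7`.
  have hconst : L / (x ^ 7 - 0 * x ^ 0 - 1) / (x ^ 6 - 0 * x ^ 0 - 1) / x ^ 15 =
      N / ((x + 1) ^ 2 * (6 * x + 7)) := by
    rw [hL, div_div, div_div, div_div]
    congr 1
    rw [hx]
    linear_combination (7 * x ^ 6 - 1) * x ^ 15 * h6 +
      (7 * x ^ 14 + (6 * x + 7) * (x ^ 7 + x + 1)) * hx
  rw [← hconst, ← tendsto_add_atTop_iff_nat 15]
  refine (hDlim.div_const (x ^ 15)).congr fun n => ?_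
  rw [div_div, ← pow_add]

end PalindromeCount

open PalindromeCount

theorem corollary8 :
    -- the initial values for `0 ≤ n ≤ 41`
    (∀ i : Fin 42, palCount 2 11 i =
      ![1, 2, 4, 8, 16, 32, 64, 128, 256, 512, 1024, 292, 270, 268, 276, 276, 288,
        320, 340, 364, 388, 404, 428, 476, 512, 560, 610, 644, 692, 768, 840, 924,
        1020, 1100, 1190, 1316, 1452, 1612, 1786, 1952, 2134, 2348] i) ∧
    -- the linear recurrence for `n ≥ 42`
    (∀ n : ℕ, 42 ≤ n →
      (palCount 2 11 n : ℤ) =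
        - palCount 2 11 (n - 1) - palCount 2 11 (n - 2) - palCount 2 11 (n - 3)
        - palCount 2 11 (n - 4) - palCount 2 11 (n - 5) + 2 * palCount 2 11 (n - 6)
        + 4 * palCount 2 11 (n - 7) + 5 * palCount 2 11 (n - 8) + 5 * palCount 2 11 (n - 9)
        + 5 * palCount 2 11 (n - 10) + 5 * palCount 2 11 (n - 11)
        + 2 * palCount 2 11 (n - 12) - 3 * palCount 2 11 (n - 13) - 6 * palCount 2 11 (n - 14)
        - 8 * palCount 2 11 (n - 15) - 8 * palCount 2 11 (n - 16)
        - 8 * palCount 2 11 (n - 17) - 7 * palCount 2 11 (n - 18) - 3 * palCount 2 11 (n - 19)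
        + 3 * palCount 2 11 (n - 21) + 4 * palCount 2 11 (n - 22)
        + 4 * palCount 2 11 (n - 23) + 4 * palCount 2 11 (n - 24)
        + 3 * palCount 2 11 (n - 25) + 2 * palCount 2 11 (n - 26) + palCount 2 11 (n - 27)) ∧
    -- the asymptotics; both decimal values are correct to within half a unit of the last digit
    (∃ α c : ℝ,
      IsGreatest {x : ℝ | x ^ 7 - x - 1 = 0} α ∧
      |α - 1.1127756842787054706297| < 1 / 2 * (10 : ℝ) ^ (-22 : ℤ) ∧
      |c - 20.665| < 1 / 2 * (10 : ℝ) ^ (-3 : ℤ) ∧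
      (fun n : ℕ => (palCount 2 11 n : ℝ)) ~[atTop] (fun n : ℕ => c * α ^ n)) := by
  refine ⟨palCount_initial, palCount_recurrence, ?_⟩
  obtain ⟨x, hlo, hhi, hx⟩ := exists_root
  -- Seven decimals of the root suffice for the three decimals of `c`.
  have hlo' : 1.1127756 ≤ x := by norm_num at hlo ⊢; linarith
  have hhi' : x ≤ 1.1127757 := by norm_num at hhi ⊢; linarith
  have hx1 : 1 < x := by linarith
  have hx0 : 0 < x := by linarith
  have hlim := palCount_tendsto hx1 (by linarith) hx
  set c := (192 + 176 * x + 160 * x ^ 2 + 144 * x ^ 3 + 128 * x ^ 4 + 112 * x ^ 5 +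
    100 * (x ^ 6 - 1)) / ((x + 1) ^ 2 * (6 * x + 7)) with hc
  have hbound : |c - 20.665| < 1 / 2 * (10 : ℝ) ^ (-3 : ℤ) := by
    have hl (k : ℕ) : 1.1127756 ^ k ≤ x ^ k := by gcongr
    have hh (k : ℕ) : x ^ k ≤ 1.1127757 ^ k := by gcongr
    have l2 := hl 2
    have l3 := hl 3
    have l4 := hl 4
    have l5 := hl 5
    have l6 := hl 6
    have u2 := hh 2
    have u3 := hh 3
    have u4 := hh 4
    have u5 := hh 5
    have u6 := hh 6
    have hden : 0 < (x + 1) ^ 2 * (6 * x + 7) := by positivity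
    norm_num at l2 l3 l4 l5 l6 u2 u3 u4 u5 u6 hlo' hhi'
    rw [abs_lt, neg_lt_sub_iff_lt_add, sub_lt_iff_lt_add, ← sub_lt_iff_lt_add', hc,
      div_lt_iff₀ hden, lt_div_iff₀ hden]
    norm_num
    constructor <;> nlinarith
  have hc0 : c ≠ 0 := by
    rintro h
    rw [h] at hbound
    norm_num [abs_lt] at hbound
  refine ⟨x, c, isGreatest_root hx1 hx, ?_, hbound, ?_⟩
  · rw [abs_lt]
    norm_num at hlo hhi ⊢
    constructor <;> linarith
  · rw [isEquivalent_iff_tendsto_one (Eventually.of_forall fun n => by positivity)]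
    have h := hlim.div_const c
    rw [div_self hc0] at h
    refine h.congr fun n => ?_
    simp only [Pi.div_apply]
    rw [div_div, mul_comm c]
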